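/- For simple graphs $X$ and $Y$ with the same finite number of vertices, let $\mathsf{FS}(X,Y)$ be the graph whose vertices are the bijections $V(X)\to V(Y)$, where $\sigma$ and $\tau$ are adjacent if and only if there is an edge $\{a,b\}$ of $X$ such that $\{\sigma(a),\sigma(b)\}\in E(Y)$, $\sigma(a)=\tau(b)$, $\sigma(b)=\tau(a)$, and $\sigma(c)=\tau(c)$ for all $c\in V(X)\setminus\{a,b\}$. Let $\mathsf{Cycle}_n$ be the cycle graph on $n$ vertices. The diameter of a connected component $\mathscr C$ of a graph is $\max_{v,w\in V(\mathscr C)} d(v,w)$, where $d(v,w)$ is the length of a shortest path from $v$ to $w$. **Theorem.** Let $Y$ be a simple graph on $n\ge 3$ vertices, and let $n_1,\dots,n_r$ be the numbers of vertices of the connected components of the complement $\overline{Y}$. If $\gcd(n_1,\dots,n_r)=1$, then every connected component of $\mathsf{FS}(\mathsf{Cycle}_n,Y)$ has diameter at most $4n^3+|E(Y)|$. -/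

import Mathlib

/-- The friends-and-strangers graph of `X` and `Y`: its vertices are the bijections from the vertices
of `X` to the vertices of `Y`; two bijections are adjacent iff they differ exactly by exchanging the
images of the two ends of an edge of `X`, those images being adjacent in `Y`. -/
def friendsAndStrangers {V W : Type*} (X : SimpleGraph V) (Y : SimpleGraph W) :
    SimpleGraph (V ≃ W) where
  Adj σ τ := ∃ a b : V, X.Adj a b ∧ Y.Adj (σ a) (σ b) ∧ σ a = τ b ∧ σ b = τ a ∧
    ∀ c : V, c ≠ a → c ≠ b → σ c = τ c
  symm := ⟨by
    rintro σ τ ⟨a, b, hX, hY, hab, hba, hc⟩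
    refine ⟨a, b, hX, ?_, hba.symm, hab.symm, fun c h1 h2 => (hc c h1 h2).symm⟩
    rw [← hab, ← hba]
    exact hY.symm⟩
  loopless := ⟨by
    rintro σ ⟨a, b, hX, -, hab, -, -⟩
    exact hX.ne (σ.injective hab)⟩

/-- The diameter of a connected component `C` of `G`: the supremum, in the extended natural numbers,
of the distances in `G` between vertices of `C`. -/
noncomputable def componentDiam {V : Type*} (G : SimpleGraph V) (C : G.ConnectedComponent) : ℕ∞ :=
  ⨆ v ∈ C.supp, ⨆ w ∈ C.supp, G.edist v w

/-- The greatest common divisor of the numbers of vertices of the connected components of a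
finite graph. -/
noncomputable def componentSizeGcd {V : Type*} [Finite V] (G : SimpleGraph V) : ℕ :=
  letI : Fintype G.ConnectedComponent := Fintype.ofFinite _
  (Finset.univ : Finset G.ConnectedComponent).gcd fun C => C.supp.ncard

/-! Lift positions on the cycle to integers, so that an exchange moves one vertex forward and one
backward. The sum of the lift is invariant. Floor quotients by `n` of differences change only for
the exchanged pair, an edge of `Y`, so those along edges of `Yᶜ` are invariant too
(`IsPositionLift.exists_of_reachable`).

Conversely, lifts sharing these invariants are joined greedily, each exchange lowering the quotient
discrepancy (`IsPositionLift.exists_walk`). The invariants survive adding to the target lift `n`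
times a function of total zero that is constant on components of `Yᶜ`. `exists_balancing_shift`
picks one making all displacements at most `2 * n ^ 2`, which bounds the walk by `2 * n ^ 3`. -/

/-- `f` assigns to every vertex of `W` an integer lifting its position on the cycle under `σ`. -/
def IsPositionLift {W : Type*} {n : ℕ} (σ : Fin n ≃ W) (f : W → ℤ) : Prop :=
  ∀ i, f (σ i) ≡ (i.val : ℤ) [ZMOD n]

/-- The position function obtained from `f` by moving `u` one step forward and `v` one step
backward. -/
noncomputable def shiftPair {W : Type*} [DecidableEq W] (f : W → ℤ) (u v : W) : W → ℤ :=
  f + Pi.single u 1 - Pi.single v 1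

section Shift

variable {W : Type*} [DecidableEq W] {f : W → ℤ} {u v : W}

theorem shiftPair_left (h : u ≠ v) : shiftPair f u v u = f u + 1 := by
  simp [shiftPair, h]

theorem shiftPair_right (h : u ≠ v) : shiftPair f u v v = f v - 1 := by
  simp [shiftPair, h.symm]

theorem shiftPair_of_ne {x : W} (hu : x ≠ u) (hv : x ≠ v) : shiftPair f u v x = f x := by
  simp [shiftPair, hu, hv]

theorem sum_shiftPair [Fintype W] : ∑ x, shiftPair f u v x = ∑ x, f x := by
  simp [shiftPair, Finset.sum_add_distrib, Finset.sum_sub_distrib]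

end Shift

theorem Int.add_one_ediv_of_not_dvd {a n : ℤ} (hn : 0 < n) (h : ¬ n ∣ a + 1) :
    (a + 1) / n = a / n := by
  have h1 := Int.mul_ediv_add_emod a n
  have h2 := Int.emod_nonneg a hn.ne'
  have h3 := Int.emod_lt_of_pos a hn
  have h4 : a % n + 1 ≠ n := fun h5 => h ⟨a / n + 1, by linarith⟩
  rw [Int.ediv_eq_iff_of_pos hn]
  constructor
  · linarith
  · have : a % n + 1 < n := by omega
    linarith

theorem Int.sub_one_ediv_of_not_dvd {a n : ℤ} (hn : 0 < n) (h : ¬ n ∣ a) :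
    (a - 1) / n = a / n := by
  have := Int.add_one_ediv_of_not_dvd (a := a - 1) hn (by simpa using h)
  simpa using this.symm

/-- Ties the quotients of `(u, v)` and `(v, u)`: an exchange shifts both by one. -/
theorem Int.neg_ediv_of_not_dvd {a n : ℤ} (hn : 0 < n) (h : ¬ n ∣ a) :
    (-a) / n = -(a / n) - 1 := by
  have h1 := Int.mul_ediv_add_emod a n
  have h2 := Int.emod_nonneg a hn.ne'
  have h3 := Int.emod_lt_of_pos a hn
  have h4 : a % n ≠ 0 := fun h5 => h (Int.dvd_of_emod_eq_zero h5)
  rw [Int.ediv_eq_iff_of_pos hn]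
  have : 0 < a % n := by omega
  constructor <;> linarith

/-! ### Integer lifts of positions -/

section Lift

variable {W : Type*} {n : ℕ} {σ τ : Fin n ≃ W} {f g : W → ℤ}

theorem IsPositionLift.eq_of_dvd (hf : IsPositionLift σ f) {u v : W}
    (h : (n : ℤ) ∣ f u - f v) : u = v := by
  obtain ⟨i, rfl⟩ := σ.surjective u
  obtain ⟨j, rfl⟩ := σ.surjective v
  have h1 : (i.val : ℤ) ≡ j.val [ZMOD n] :=
    ((hf i).symm.trans (Int.modEq_iff_dvd.2 h).symm).trans (hf j)
  have h2 : i.val ≡ j.val [MOD n] := Int.natCast_modEq_iff.1 h1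
  exact congrArg σ (Fin.ext (h2.eq_of_lt_of_lt i.2 j.2))

theorem IsPositionLift.unique (hf : IsPositionLift σ f) (hg : IsPositionLift τ f) : σ = τ := by
  ext i
  refine hf.eq_of_dvd ?_
  exact Int.modEq_iff_dvd.1 ((hg i).trans (hf i).symm)

theorem IsPositionLift.add_mul (hf : IsPositionLift σ f) (z : W → ℤ) :
    IsPositionLift σ (fun x => f x + n * z x) := by
  intro i
  have : f (σ i) + n * z (σ i) ≡ f (σ i) [ZMOD n] := by simp [Int.ModEq]
  exact this.trans (hf i)

theorem exists_isPositionLift (σ : Fin n ≃ W) : ∃ f, IsPositionLift σ f :=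
  ⟨fun x => (σ.symm x).val, fun i => by simp [Int.ModEq]⟩

variable [DecidableEq W]

theorem IsPositionLift.swap_trans (hf : IsPositionLift σ f) {a b : Fin n}
    (hab : f (σ b) ≡ f (σ a) + 1 [ZMOD n]) (hne : a ≠ b) :
    IsPositionLift ((Equiv.swap a b).trans σ) (shiftPair f (σ a) (σ b)) := by
  have hne' : σ a ≠ σ b := σ.injective.ne hne
  intro i
  by_cases hia : i = a
  · subst hia
    simp only [Equiv.trans_apply, Equiv.swap_apply_left, shiftPair_right hne']
    have := (hab.sub_right 1).trans (by simpa using hf i)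
    simpa using this
  by_cases hib : i = b
  · subst hib
    simp only [Equiv.trans_apply, Equiv.swap_apply_right, shiftPair_left hne']
    exact hab.symm.trans (hf i)
  · rw [Equiv.trans_apply, Equiv.swap_apply_of_ne_of_ne hia hib,
      shiftPair_of_ne (σ.injective.ne hia) (σ.injective.ne hib)]
    exact hf i

/-- Exchanging two neighbours changes no quotient other than those of the exchanged pair. -/
theorem IsPositionLift.ediv_shiftPair (hn : 2 ≤ n) (hf : IsPositionLift σ f) {u v : W}
    (huv : f v ≡ f u + 1 [ZMOD n]) (hne : u ≠ v) {x y : W}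
    (h1 : ¬ (x = u ∧ y = v)) (h2 : ¬ (x = v ∧ y = u)) :
    (shiftPair f u v x - shiftPair f u v y) / (n : ℤ) = (f x - f y) / n := by
  have hn0 : (0 : ℤ) < n := by exact_mod_cast (by omega : 0 < n)
  have hd : (n : ℤ) ∣ f u + 1 - f v := Int.modEq_iff_dvd.1 huv
  by_cases hxy : x = y
  · subst hxy; simp
  by_cases hxu : x = u
  · subst hxu
    have hyv : y ≠ v := fun h => h1 ⟨rfl, h⟩
    rw [shiftPair_left hne, shiftPair_of_ne (Ne.symm hxy) hyv, add_sub_right_comm]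
    refine Int.add_one_ediv_of_not_dvd hn0 fun h => hyv (hf.eq_of_dvd ?_)
    have := dvd_sub hd h
    ring_nf at this ⊢
    exact this
  by_cases hxv : x = v
  · subst hxv
    have hyu : y ≠ u := fun h => h2 ⟨rfl, h⟩
    rw [shiftPair_right hne, shiftPair_of_ne hyu (Ne.symm hxy), sub_right_comm]
    exact Int.sub_one_ediv_of_not_dvd hn0 fun h => hxy (hf.eq_of_dvd h)
  rw [shiftPair_of_ne hxu hxv]
  by_cases hyu : y = u
  · subst hyu
    rw [shiftPair_left hne, ← sub_sub]
    exact Int.sub_one_ediv_of_not_dvd hn0 fun h => hxy (hf.eq_of_dvd h)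
  by_cases hyv : y = v
  · subst hyv
    rw [shiftPair_right hne, ← sub_add]
    refine Int.add_one_ediv_of_not_dvd hn0 fun h => hxu (hf.eq_of_dvd ?_)
    have := dvd_sub h hd
    ring_nf at this ⊢
    exact this
  · rw [shiftPair_of_ne hyu hyv]

end Lift

/-! ### Steps around the cycle -/

section Cycle

variable {n : ℕ}

theorem cycleGraph_adj_iff_modEq (hn : 2 ≤ n) {a b : Fin n} :
    (SimpleGraph.cycleGraph n).Adj a b ↔
      (b.val : ℤ) ≡ a.val + 1 [ZMOD n] ∨ (a.val : ℤ) ≡ b.val + 1 [ZMOD n] := by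
  have key : ∀ a b : Fin n, (a - b).val = 1 ↔ (a.val : ℤ) ≡ b.val + 1 [ZMOD n] := by
    intro a b
    have ha := a.2
    have hb := b.2
    have h1 : (a.val : ℤ) ≡ b.val + 1 [ZMOD n] ↔ a.val ≡ b.val + 1 [MOD n] := by
      rw [← Int.natCast_modEq_iff]; push_cast; rfl
    rw [h1, Fin.sub_def, Nat.ModEq, Nat.mod_eq_of_lt ha]
    dsimp only
    rcases le_or_gt b.val a.val with h | h
    · rw [show n - b.val + a.val = (a.val - b.val) + n by omega, Nat.add_mod_right,
        Nat.mod_eq_of_lt (by omega)]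
      rcases Nat.lt_or_ge (b.val + 1) n with h2 | h2
      · rw [Nat.mod_eq_of_lt h2]; omega
      · rw [show b.val + 1 = n by omega, Nat.mod_self]; omega
    · rw [Nat.mod_eq_of_lt (by omega)]
      rcases Nat.lt_or_ge (b.val + 1) n with h2 | h2
      · rw [Nat.mod_eq_of_lt h2]; omega
      · rw [show b.val + 1 = n by omega, Nat.mod_self]; omega
  rw [SimpleGraph.cycleGraph_adj', key, key, or_comm]

/-- A function on a cycle that never decreases is constant. -/
theorem eq_of_forall_le_cyclic_succ (d : Fin n → ℤ)
    (h : ∀ i j : Fin n, (j.val : ℤ) ≡ i.val + 1 [ZMOD n] → d i ≤ d j) (i j : Fin n) :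
    d i = d j := by
  have h0 : 0 < n := by have := i.2; omega
  have hstep : ∀ k l : ℕ, k ≤ l → d ⟨k % n, Nat.mod_lt _ h0⟩ ≤ d ⟨l % n, Nat.mod_lt _ h0⟩ := by
    intro k l hkl
    induction l, hkl using Nat.le_induction with
    | base => rfl
    | succ l _ ih =>
      refine ih.trans (h _ _ ?_)
      push_cast
      simp [Int.ModEq]
  have hle : ∀ i j : Fin n, d i ≤ d j := by
    intro i j
    -- The extra turn ensures that `j` is reached going forward from `i`.
    have := hstep i.val (j.val + n) (by have := i.2; omega)
    simpa [Nat.mod_eq_of_lt i.2, Nat.mod_eq_of_lt j.2] using this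
  exact le_antisymm (hle i j) (hle j i)

end Cycle

/-! ### Invariants and greedy walks -/

section Walk

variable {V : Type*} {n : ℕ} {Y : SimpleGraph V} {σ τ : Fin n ≃ V} {f g : V → ℤ}

theorem IsPositionLift.exists_of_adj [Fintype V] (hn : 2 ≤ n)
    (h : (friendsAndStrangers (SimpleGraph.cycleGraph n) Y).Adj σ τ) (hf : IsPositionLift σ f) :
    ∃ g, IsPositionLift τ g ∧ ∑ x, g x = ∑ x, f x ∧
      ∀ u v, Yᶜ.Adj u v → (g u - g v) / (n : ℤ) = (f u - f v) / n := by
  classical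
  have main : ∀ a b : Fin n, (b.val : ℤ) ≡ a.val + 1 [ZMOD n] → a ≠ b → Y.Adj (σ a) (σ b) →
      σ a = τ b → σ b = τ a → (∀ c, c ≠ a → c ≠ b → σ c = τ c) →
      ∃ g, IsPositionLift τ g ∧ ∑ x, g x = ∑ x, f x ∧
        ∀ u v, Yᶜ.Adj u v → (g u - g v) / (n : ℤ) = (f u - f v) / n := by
    intro a b hab hne hY h1 h2 h3
    have hτ : τ = (Equiv.swap a b).trans σ := by
      ext i
      by_cases hia : i = a
      · subst hia; simp [h2]
      by_cases hib : i = b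
      · subst hib; simp [h1]
      · rw [Equiv.trans_apply, Equiv.swap_apply_of_ne_of_ne hia hib, h3 i hia hib]
    have hab' : f (σ b) ≡ f (σ a) + 1 [ZMOD n] :=
      ((hf b).trans hab).trans ((hf a).symm.add_right 1)
    refine ⟨shiftPair f (σ a) (σ b), hτ ▸ hf.swap_trans hab' hne, sum_shiftPair, ?_⟩
    intro u v huv
    refine hf.ediv_shiftPair hn hab' hY.ne ?_ ?_
    · rintro ⟨rfl, rfl⟩; exact huv.2 hY
    · rintro ⟨rfl, rfl⟩; exact huv.2 hY.symm
  obtain ⟨a, b, hX, hY, h1, h2, h3⟩ := h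
  rcases (cycleGraph_adj_iff_modEq hn).1 hX with hab | hab
  · exact main a b hab hX.ne hY h1 h2 h3
  · exact main b a hab hX.ne.symm hY.symm h2 h1 fun c hb ha => h3 c ha hb

theorem IsPositionLift.exists_of_reachable [Fintype V] (hn : 2 ≤ n)
    (h : (friendsAndStrangers (SimpleGraph.cycleGraph n) Y).Reachable σ τ)
    (hf : IsPositionLift σ f) :
    ∃ g, IsPositionLift τ g ∧ ∑ x, g x = ∑ x, f x ∧
      ∀ u v, Yᶜ.Adj u v → (g u - g v) / (n : ℤ) = (f u - f v) / n := by
  obtain ⟨w⟩ := h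
  induction w generalizing f with
  | nil => exact ⟨f, hf, rfl, fun _ _ _ => rfl⟩
  | cons hadj _ ih =>
    obtain ⟨g, hg, hgs, hgd⟩ := hf.exists_of_adj hn hadj
    obtain ⟨k, hk, hks, hkd⟩ := ih hg
    exact ⟨k, hk, hks.trans hgs, fun u v huv => (hkd u v huv).trans (hgd u v huv)⟩

/-- Two position functions with equal sums that differ have a neighbouring pair in the wrong
order. -/
theorem exists_descent [Fintype V] (σ : Fin n ≃ V)
    (hsum : ∑ x, g x = ∑ x, f x) (hne : f ≠ g) :
    ∃ a b : Fin n, (b.val : ℤ) ≡ a.val + 1 [ZMOD n] ∧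
      g (σ b) - g (σ a) < f (σ b) - f (σ a) := by
  by_contra! hcon
  refine hne (funext fun x => ?_)
  have hconst : ∀ y, g y - f y = g x - f x := by
    intro y
    have := eq_of_forall_le_cyclic_succ (fun i => g (σ i) - f (σ i))
      (fun i j hij => by have := hcon i j hij; linarith) (σ.symm y) (σ.symm x)
    simpa using this
  have h0 : ∑ y, (g y - f y) = 0 := by rw [Finset.sum_sub_distrib, hsum, sub_self]
  rw [Finset.sum_congr rfl fun y _ => hconst y, Finset.sum_const, smul_eq_zero] at h0
  rcases h0 with h0 | h0
  · exact absurd h0 (Finset.card_ne_zero_of_mem (Finset.mem_univ x))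
  · linarith

/-- Position functions with equal sums and equal quotients along the edges of `Yᶜ` are joined by a
walk; its length is controlled by the total change of the quotients. -/
theorem IsPositionLift.exists_walk [Fintype V] (hn : 2 ≤ n) (hf : IsPositionLift σ f)
    (hg : IsPositionLift τ g) (hsum : ∑ x, g x = ∑ x, f x)
    (hdiv : ∀ u v, Yᶜ.Adj u v → (g u - g v) / (n : ℤ) = (f u - f v) / n) :
    ∃ w : (friendsAndStrangers (SimpleGraph.cycleGraph n) Y).Walk σ τ,
      2 * (w.length : ℤ) ≤ ∑ p : V × V, |(g p.1 - g p.2) / (n : ℤ) - (f p.1 - f p.2) / n| := by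
  classical
  obtain ⟨N, hN⟩ : ∃ N : ℕ,
      (∑ p : V × V, |(g p.1 - g p.2) / (n : ℤ) - (f p.1 - f p.2) / n|).toNat = N := ⟨_, rfl⟩
  induction N using Nat.strong_induction_on generalizing σ f with
  | _ N ih =>
  by_cases hfg : f = g
  · subst hfg
    obtain rfl := hf.unique hg
    exact ⟨.nil, by simp⟩
  obtain ⟨a, b, hab, hlt⟩ := exists_descent σ hsum hfg
  have hn0 : (0 : ℤ) < n := by exact_mod_cast (by omega : 0 < n)
  have hn2 : (2 : ℤ) ≤ n := by exact_mod_cast hn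
  have hne : a ≠ b := by
    rintro rfl
    simp at hlt
  have hne' : σ a ≠ σ b := σ.injective.ne hne
  have hab' : f (σ b) ≡ f (σ a) + 1 [ZMOD n] :=
    ((hf b).trans hab).trans ((hf a).symm.add_right 1)
  set u := σ a with hu
  set v := σ b with hv
  obtain ⟨c, hc⟩ : ∃ c, f v - f u = c * n + 1 := by
    obtain ⟨c, hc⟩ := Int.modEq_iff_dvd.1 hab'.symm
    exact ⟨c, by linarith⟩
  have hkf : (f v - f u) / (n : ℤ) = c := by
    rw [hc, Int.ediv_eq_iff_of_pos hn0]; constructor <;> linarith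
  have hnd : ¬ (n : ℤ) ∣ g v - g u := fun h => hne' (hg.eq_of_dvd h).symm
  -- The descent gives `g v - g u ≤ c * n`; equality would put `u` and `v` at the same position
  -- under `τ`.
  have hkg : (g v - g u) / (n : ℤ) < c := by
    rw [Int.ediv_lt_iff_lt_mul hn0]
    rcases lt_or_eq_of_le (show g v - g u ≤ c * n by linarith) with h | h
    · exact h
    · exact absurd ⟨c, by rw [h, mul_comm]⟩ hnd
  -- The quotients of `(v, u)` under `f` and `g` differ, which `hdiv` forbids on edges of `Yᶜ`.
  have hY : Y.Adj u v := by
    by_contra hY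
    have := hdiv v u (SimpleGraph.compl_adj _ _ _ |>.2 ⟨hne'.symm, fun h => hY h.symm⟩)
    omega
  set f' := shiftPair f u v with hf'
  set σ' := (Equiv.swap a b).trans σ with hσ'
  have hlift : IsPositionLift σ' f' := hf.swap_trans hab' hne
  have hother : ∀ x y, ¬ (x = u ∧ y = v) → ¬ (x = v ∧ y = u) →
      (f' x - f' y) / (n : ℤ) = (f x - f y) / n :=
    fun x y h1 h2 => hf.ediv_shiftPair hn hab' hne' h1 h2
  have hkf' : (f' v - f' u) / (n : ℤ) = c - 1 := by
    rw [hf', shiftPair_left hne', shiftPair_right hne', Int.ediv_eq_iff_of_pos hn0]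
    constructor <;> linarith
  have hflip : ∀ k : V → ℤ, ∀ ρ : Fin n ≃ V, IsPositionLift ρ k →
      (k u - k v) / (n : ℤ) = -((k v - k u) / n) - 1 := by
    intro k ρ hk
    rw [← Int.neg_ediv_of_not_dvd hn0 fun h => hne' (hk.eq_of_dvd h).symm, neg_sub]
  -- Each of the two orderings of the exchanged pair contributes one.
  have hsum' : ∑ p : V × V, |(g p.1 - g p.2) / (n : ℤ) - (f' p.1 - f' p.2) / n| + 2 =
      ∑ p : V × V, |(g p.1 - g p.2) / (n : ℤ) - (f p.1 - f p.2) / n| := by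
    have huv : (u, v) ≠ (v, u) := fun h => hne' (Prod.ext_iff.1 h).1
    have h2 : (2 : ℤ) = ∑ p : V × V, ((if p = (u, v) then 1 else 0) +
        if p = (v, u) then 1 else 0) := by
      rw [Finset.sum_add_distrib]; simp
    rw [h2, ← Finset.sum_add_distrib]
    refine Finset.sum_congr rfl ?_
    rintro ⟨x, y⟩ -
    by_cases h1 : (x, y) = (u, v)
    · obtain ⟨rfl, rfl⟩ := Prod.ext_iff.1 h1
      rw [if_pos rfl, if_neg huv]
      dsimp only
      rw [hflip g τ hg, hflip f σ hf, hflip f' σ' hlift, hkf, hkf', abs_of_nonneg (by omega),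
        abs_of_nonneg (by omega)]
      ring
    by_cases h2 : (x, y) = (v, u)
    · obtain ⟨rfl, rfl⟩ := Prod.ext_iff.1 h2
      rw [if_pos rfl, if_neg huv.symm]
      dsimp only
      rw [hkf, hkf', abs_of_nonpos (by omega), abs_of_nonpos (by omega)]
      ring
    · rw [if_neg h1, if_neg h2]
      dsimp only
      rw [hother x y (fun h => h1 (Prod.ext h.1 h.2)) (fun h => h2 (Prod.ext h.1 h.2))]
      ring
  have hnonneg : 0 ≤ ∑ p : V × V, |(g p.1 - g p.2) / (n : ℤ) - (f' p.1 - f' p.2) / n| :=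
    Finset.sum_nonneg fun _ _ => abs_nonneg _
  obtain ⟨w, hw⟩ := ih _ (by omega) hlift (hsum.trans sum_shiftPair.symm) (fun x y hxy => by
    rw [hdiv x y hxy, hother x y]
    · rintro ⟨rfl, rfl⟩; exact hxy.2 hY
    · rintro ⟨rfl, rfl⟩; exact hxy.2 hY.symm) rfl
  have hadj : (friendsAndStrangers (SimpleGraph.cycleGraph n) Y).Adj σ σ' := by
    refine ⟨a, b, (cycleGraph_adj_iff_modEq hn).2 (Or.inl hab), hY, ?_, ?_, ?_⟩
    · simp [hσ']
    · simp [hσ']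
    · intro x hxa hxb
      rw [hσ', Equiv.trans_apply, Equiv.swap_apply_of_ne_of_ne hxa hxb]
  refine ⟨.cons hadj w, ?_⟩
  rw [SimpleGraph.Walk.length_cons]
  push_cast
  linarith

end Walk

/-! ### Balancing the components -/

/-- A function of bounded spread along edges has bounded spread on connected components. -/
theorem SimpleGraph.Reachable.abs_sub_le {V : Type*} [Fintype V] {G : SimpleGraph V} {d : V → ℤ}
    {B : ℤ} (hB : 0 ≤ B) (h : ∀ u v, G.Adj u v → |d u - d v| ≤ B) {u v : V}
    (huv : G.Reachable u v) : |d u - d v| ≤ Fintype.card V * B := by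
  classical
  have hw : ∀ {u v : V} (w : G.Walk u v), |d u - d v| ≤ w.length * B := by
    intro u v w
    induction w with
    | nil => simp
    | @cons u x v hadj w ih =>
      have h1 := _root_.abs_sub_le (d u) (d x) (d v)
      have h2 := h _ _ hadj
      rw [SimpleGraph.Walk.length_cons]
      push_cast
      linarith
  obtain ⟨w⟩ := huv
  have hlt := w.toPath.2.length_lt
  refine (hw (w.toPath : G.Walk u v)).trans (mul_le_mul_of_nonneg_right ?_ hB)
  exact_mod_cast hlt.le

/-- A function of total sum zero with spread at most `n ^ 2` on the fibres of `c` can be made small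
by adding `n` times a function of total sum zero that is constant on the fibres of `c`. -/
theorem exists_balancing_shift {V ι : Type*} [Fintype V] [Fintype ι] [DecidableEq ι] [Nonempty V]
    (c : V → ι) {n : ℕ} (hn : Fintype.card V = n) (d : V → ℤ) (hd : ∑ x, d x = 0)
    (hspread : ∀ u v, c u = c v → |d u - d v| ≤ (n : ℤ) ^ 2) :
    ∃ z : ι → ℤ, ∑ x, z (c x) = 0 ∧ ∀ u, |d u + n * z (c u)| ≤ 2 * (n : ℤ) ^ 2 := by
  classical
  let F : ι → Finset V := fun i => Finset.univ.filter fun x => c x = i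
  obtain ⟨x₀⟩ := ‹Nonempty V›
  set K := c x₀ with hK
  have hn0 : (0 : ℤ) < n := by
    rw [← hn]; exact_mod_cast Fintype.card_pos_iff.2 ⟨x₀⟩
  have hcard : ∑ i, ((F i).card : ℤ) = n := by
    rw [← hn, ← Finset.card_univ, Finset.card_eq_sum_card_fiberwise (f := c) (t := Finset.univ)
      (fun _ _ => Finset.mem_coe.2 (Finset.mem_univ _))]
    push_cast; rfl
  have hsumF : ∀ e : V → ℤ, ∑ x, e x = ∑ i, ∑ x ∈ F i, e x := fun e =>
    (Finset.sum_fiberwise Finset.univ c e).symm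
  have hcle : ∀ i, ((F i).card : ℤ) ≤ n := fun i =>
    hcard ▸ Finset.single_le_sum (f := fun i => ((F i).card : ℤ)) (fun _ _ => by positivity)
      (Finset.mem_univ i)
  have hpos : ∀ x, (0 : ℤ) < (F (c x)).card := fun x => by
    exact_mod_cast Finset.card_pos.2 ⟨x, by simp [F]⟩
  obtain ⟨m, hm⟩ : ∃ m : ℤ, m = (F K).card := ⟨_, rfl⟩
  have hm0 : 0 < m := hm ▸ hpos x₀
  let S : ι → ℤ := fun i => ∑ x ∈ F i, d x
  -- Off `K`, the shift reduces the fibre sum `S i` to its remainder modulo `n * m * (F i).card`.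
  -- The factor `m`, the size of the fibre over `K`, lets an integer `z K` cancel the total of the
  -- other shifts.
  let t : ι → ℤ := fun i => -(S i / (n * m * (F i).card))
  let z : ι → ℤ := fun i =>
    if i = K then -∑ j ∈ Finset.univ.erase K, (F j).card * t j else m * t i
  have hconst : ∀ i, ∑ x ∈ F i, z (c x) = (F i).card * z i := fun i => by
    rw [Finset.sum_congr rfl (g := fun _ => z i) fun x hx => by rw [(Finset.mem_filter.1 hx).2],
      Finset.sum_const, nsmul_eq_mul]
  have hzK : z K = -∑ j ∈ Finset.univ.erase K, (F j).card * t j := if_pos rfl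
  have hz : ∀ i, i ≠ K → z i = m * t i := fun i hi => if_neg hi
  have hz0 : ∑ x, z (c x) = 0 := by
    have hrest : ∑ i ∈ Finset.univ.erase K, (F i).card * z i =
        m * ∑ i ∈ Finset.univ.erase K, (F i).card * t i := by
      rw [Finset.mul_sum]
      refine Finset.sum_congr rfl fun i hi => ?_
      rw [hz i (Finset.ne_of_mem_erase hi)]
      ring
    rw [hsumF, Finset.sum_congr rfl fun i _ => hconst i, ← Finset.add_sum_erase _ _
      (Finset.mem_univ K), hrest, hzK, ← hm]
    ring
  let T : ι → ℤ := fun i => ∑ x ∈ F i, (d x + n * z (c x))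
  have hT : ∀ i, T i = S i + n * ((F i).card * z i) := fun i => by
    rw [← hconst, Finset.mul_sum, ← Finset.sum_add_distrib]
  have hTother : ∀ i, i ≠ K → 0 ≤ T i ∧ T i ≤ n * m * (F i).card := by
    intro i hi
    have hTi : T i = S i - n * m * (F i).card * (S i / (n * m * (F i).card)) := by
      rw [hT, hz i hi]; simp only [t]; ring
    rcases (F i).card.eq_zero_or_pos with h0 | h0
    · have hS : S i = 0 := by simp [S, Finset.card_eq_zero.1 h0]
      rw [hTi, h0, hS]; simp
    · have hp : 0 < n * m * ((F i).card : ℤ) := by positivity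
      have h1 := Int.mul_ediv_add_emod (S i) (n * m * (F i).card)
      have h2 := Int.emod_nonneg (S i) hp.ne'
      have h3 := Int.emod_lt_of_pos (S i) hp
      constructor <;> linarith
  have hTsum : ∑ i, T i = 0 := by
    rw [← hsumF, Finset.sum_add_distrib, hd, ← Finset.mul_sum, hz0]; simp
  have hTK : -(n * m * n) ≤ T K ∧ T K ≤ 0 := by
    rw [← Finset.add_sum_erase _ _ (Finset.mem_univ K)] at hTsum hcard
    have h1 : 0 ≤ ∑ i ∈ Finset.univ.erase K, T i :=
      Finset.sum_nonneg fun i hi => (hTother i (Finset.ne_of_mem_erase hi)).1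
    have h2 : ∑ i ∈ Finset.univ.erase K, T i ≤
        ∑ i ∈ Finset.univ.erase K, n * m * ((F i).card : ℤ) :=
      Finset.sum_le_sum fun i hi => (hTother i (Finset.ne_of_mem_erase hi)).2
    rw [← Finset.mul_sum] at h2
    have h3 : ∑ i ∈ Finset.univ.erase K, ((F i).card : ℤ) ≤ n := by linarith
    have h4 := mul_le_mul_of_nonneg_left h3 (by positivity : 0 ≤ n * m)
    constructor <;> linarith
  have hTbound : ∀ i, |T i| ≤ (F i).card * (n : ℤ) ^ 2 := by
    intro i
    rw [abs_le]
    by_cases hi : i = K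
    · subst hi
      have : 0 ≤ m * (n : ℤ) ^ 2 := by positivity
      constructor <;> nlinarith [hTK.1, hTK.2]
    · have h1 := hTother i hi
      have h2 : n * m * ((F i).card : ℤ) ≤ (F i).card * (n : ℤ) ^ 2 := by
        have := mul_le_mul_of_nonneg_left (hcle K) (by positivity : 0 ≤ n * ((F i).card : ℤ))
        nlinarith
      have : 0 ≤ (F i).card * (n : ℤ) ^ 2 := by positivity
      constructor <;> linarith
  refine ⟨z, hz0, fun u => ?_⟩
  -- The fibre average and the deviation from it are each at most `n ^ 2`.
  have hkey : (F (c u)).card * (d u + n * z (c u)) - T (c u) = ∑ x ∈ F (c u), (d u - d x) := by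
    rw [hT, Finset.sum_sub_distrib, Finset.sum_const, nsmul_eq_mul]; ring
  have hdiff : |∑ x ∈ F (c u), (d u - d x)| ≤ (F (c u)).card * (n : ℤ) ^ 2 := by
    refine (Finset.abs_sum_le_sum_abs _ _).trans ?_
    refine (Finset.sum_le_card_nsmul _ _ ((n : ℤ) ^ 2) fun x hx => ?_).trans_eq (nsmul_eq_mul _ _)
    exact hspread u x (Finset.mem_filter.1 hx).2.symm
  rw [← hkey] at hdiff
  have h1 := abs_add_le ((F (c u)).card * (d u + n * z (c u)) - T (c u)) (T (c u))
  rw [sub_add_cancel, abs_mul, abs_of_pos (hpos u)] at h1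
  refine le_of_mul_le_mul_left ?_ (hpos u)
  linarith [hTbound (c u)]

theorem Int.abs_sub_le_of_ediv_eq {a b n : ℤ} (hn : 0 < n) (h : a / n = b / n) :
    |a - b| ≤ n := by
  have h1 := Int.mul_ediv_add_emod a n
  have h2 := Int.mul_ediv_add_emod b n
  have h3 := Int.emod_nonneg a hn.ne'
  have h4 := Int.emod_lt_of_pos a hn
  have h5 := Int.emod_nonneg b hn.ne'
  have h6 := Int.emod_lt_of_pos b hn
  rw [h] at h1
  rw [abs_le]
  constructor <;> linarith

theorem Int.abs_ediv_sub_ediv_le {a b n k : ℤ} (hn : 0 < n) (h : |a - b| ≤ k * n) :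
    |a / n - b / n| ≤ k := by
  rw [abs_le] at h
  have h1 : a / n ≤ (b + k * n) / n := Int.ediv_le_ediv hn (by linarith)
  have h2 : b / n ≤ (a + k * n) / n := Int.ediv_le_ediv hn (by linarith)
  rw [Int.add_mul_ediv_right _ _ hn.ne'] at h1 h2
  rw [abs_le]
  constructor <;> linarith

/-- Two bijections in one component of `FS(Cycle_n, Y)` are at distance at most `2 * n ^ 3`. -/
theorem exists_walk_length_le_of_reachable {V : Type*} [Fintype V] {n : ℕ} (hn : 2 ≤ n)
    (hV : Fintype.card V = n) {Y : SimpleGraph V} {σ τ : Fin n ≃ V}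
    (h : (friendsAndStrangers (SimpleGraph.cycleGraph n) Y).Reachable σ τ) :
    ∃ w : (friendsAndStrangers (SimpleGraph.cycleGraph n) Y).Walk σ τ,
      w.length ≤ 2 * n ^ 3 := by
  classical
  have hn0 : (0 : ℤ) < n := by exact_mod_cast (by omega : 0 < n)
  have : Nonempty V := Fintype.card_pos_iff.1 (by omega)
  let : Fintype Yᶜ.ConnectedComponent := Fintype.ofFinite _
  obtain ⟨f, hf⟩ := exists_isPositionLift σ
  obtain ⟨g, hg, hsum, hdiv⟩ := hf.exists_of_reachable hn h
  have hspread : ∀ u v, Yᶜ.connectedComponentMk u = Yᶜ.connectedComponentMk v →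
      |(g u - f u) - (g v - f v)| ≤ (n : ℤ) ^ 2 := by
    intro u v huv
    have := (SimpleGraph.ConnectedComponent.exact huv).abs_sub_le (d := fun x => g x - f x)
      hn0.le fun x y hxy => by
        have := Int.abs_sub_le_of_ediv_eq hn0 (hdiv x y hxy)
        convert this using 2
        ring
    rw [hV] at this
    linarith
  obtain ⟨z, hz, hbound⟩ := exists_balancing_shift Yᶜ.connectedComponentMk hV
    (fun x => g x - f x) (by rw [Finset.sum_sub_distrib, hsum, sub_self]) hspread
  obtain ⟨w, hw⟩ := hf.exists_walk (Y := Y) hn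
    (hg.add_mul fun x => z (Yᶜ.connectedComponentMk x))
    (by rw [Finset.sum_add_distrib, ← Finset.mul_sum, hz, hsum]; ring)
    (fun u v huv => by
      rw [SimpleGraph.ConnectedComponent.sound huv.reachable, add_sub_add_right_eq_sub,
        hdiv u v huv])
  refine ⟨w, ?_⟩
  -- Displacements up to `2 * n ^ 2` at both ends change a difference by at most `4 * n ^ 2`, hence
  -- a quotient by at most `4 * n`.
  have hle := hw.trans (Finset.sum_le_card_nsmul _ _ (4 * n : ℤ) fun p _ => ?_)
  · rw [Finset.card_univ, Fintype.card_prod, hV, nsmul_eq_mul] at hle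
    push_cast at hle
    have : 2 * (w.length : ℤ) ≤ 2 * (2 * n ^ 3) := by linarith
    exact_mod_cast (by linarith : (w.length : ℤ) ≤ 2 * n ^ 3)
  · refine Int.abs_ediv_sub_ediv_le hn0 ?_
    have h1 := abs_le.1 (hbound p.1)
    have h2 := abs_le.1 (hbound p.2)
    rw [abs_le]
    constructor <;> linarith [h1.1, h1.2, h2.1, h2.2]

theorem theorem3p6 {V : Type*} [Fintype V] (n : ℕ) (hn : 3 ≤ n) (hV : Fintype.card V = n)
    (Y : SimpleGraph V) (hgcd : componentSizeGcd Yᶜ = 1)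
    (C : (friendsAndStrangers (SimpleGraph.cycleGraph n) Y).ConnectedComponent) :
    componentDiam (friendsAndStrangers (SimpleGraph.cycleGraph n) Y) C
      ≤ ((4 * n ^ 3 + Y.edgeSet.ncard : ℕ) : ℕ∞) := by
  refine iSup₂_le fun σ hσ => iSup₂_le fun τ hτ => ?_
  obtain ⟨w, hw⟩ := exists_walk_length_le_of_reachable (by omega) hV
    (SimpleGraph.ConnectedComponent.exact (hσ.trans hτ.symm))
  exact w.edist_le.trans (by exact_mod_cast (by omega : w.length ≤ 4 * n ^ 3 + Y.edgeSet.ncard))
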